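/- Let $\mathcal A=\{0,\dots,d-1\}$. A recurrent infinite word $\mathbf u=u_0u_1u_2\cdots$ over $\mathcal A$ (every factor occurs at least twice) is a $d$-ary Arnoux--Rauzy word if for every $n\ge 0$ it has exactly $(d-1)n+1$ factors of length $n$, exactly one of them left special (extendable to the left within the language $\mathcal L_{\mathbf u}$ by at least two letters) and exactly one right special (extendable to the right by at least two letters). It is standard if all its prefixes are left special. A factor is bispecial if it is both left and right special; an Arnoux--Rauzy word has at most one bispecial factor of each length, and $B_{\mathbf u}(0),B_{\mathbf u}(1),\dots$ denote its bispecial factors ordered by length (so $B_{\mathbf u}(0)$ is the empty word). For $i\in\mathcal A$ let $\varphi_i$ be the morphism $i\mapsto i$, $j\mapsto ij$ for $j\ne i$. A directive sequence of a standard Arnoux--Rauzy word $\mathbf v$ is a sequence $(i_n)_{n\ge0}$ of letters for which there are standard Arnoux--Rauzy words $\mathbf v^{(n)}$ with $\mathbf v=\mathbf v^{(0)}$ and $\mathbf v^{(n)}=\varphi_{i_n}(\mathbf v^{(n+1)})$ for all $n$. The non-repetitive complexity $nr\mathcal C_{\mathbf u}(n)$ is the maximal $m$ such that for some $k$ the factors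 $u_j\cdots u_{j+n-1}$, $k\le j\le k+m-1$, are pairwise distinct. Theorem. Let $\mathbf u$ be a $d$-ary Arnoux--Rauzy word. There is a unique standard Arnoux--Rauzy word $\mathbf v$ with $\mathcal L_{\mathbf v}=\mathcal L_{\mathbf u}$, and it has a unique directive sequence $(i_n)_{n\ge0}$. For every integer $n\ge1$ there is a unique $k\ge1$ with $|B_{\mathbf u}(k-1)|<n\le|B_{\mathbf u}(k)|$. For letters $a$ put $S_a(k)=\sup\{\ell:0\le\ell<k,\ i_\ell=a\}$, with $S_a(k)=-\infty$ if the set is empty. There is a letter $a\ne i_k$ with $S_a(k)=\inf\{S_b(k):b\in\mathcal A,\ b\ne i_k\}$, and for every such letter $a$ the maximum defining $nr\mathcal C_{\mathbf u}(n)$ exists and $$nr\mathcal C_{\mathbf u}(n)=|\varphi_{i_0}\varphi_{i_1}\cdots\varphi_{i_k}(a)|-1-|B_{\mathbf u}(k)|+n .$$ -/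

import Mathlib

namespace ArnouxRauzy

/-- An infinite word over the alphabet `{0, 1, ..., d - 1}`. -/
abbrev InfWord (d : ℕ) : Type := ℕ → Fin d

/-- The factor `u_p u_{p+1} ⋯ u_{p+n-1}` of length `n` occurring at position `p`. -/
def factorAt {d : ℕ} (u : InfWord d) (p n : ℕ) : List (Fin d) :=
  (List.range n).map fun t => u (p + t)

/-- The language of `u`: the set of all its (finite) factors. -/
def language {d : ℕ} (u : InfWord d) : Set (List (Fin d)) :=
  {w | ∃ p n : ℕ, factorAt u p n = w}

/-- Every factor has at least two occurrences. -/
def IsRecurrent {d : ℕ} (u : InfWord d) : Prop :=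
  ∀ w ∈ language u, ∃ p q : ℕ, p < q ∧ factorAt u p w.length = w ∧ factorAt u q w.length = w

/-- `aw` and `bw` are factors of `u` for two distinct letters `a`, `b`. -/
def IsLeftSpecial {d : ℕ} (u : InfWord d) (w : List (Fin d)) : Prop :=
  ∃ a b : Fin d, a ≠ b ∧ a :: w ∈ language u ∧ b :: w ∈ language u

/-- `wa` and `wb` are factors of `u` for two distinct letters `a`, `b`. -/
def IsRightSpecial {d : ℕ} (u : InfWord d) (w : List (Fin d)) : Prop :=
  ∃ a b : Fin d, a ≠ b ∧ w ++ [a] ∈ language u ∧ w ++ [b] ∈ language u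

/-- A factor that is both left and right special. -/
def IsBispecial {d : ℕ} (u : InfWord d) (w : List (Fin d)) : Prop :=
  IsLeftSpecial u w ∧ IsRightSpecial u w

/-- `u` is a `d`-ary Arnoux–Rauzy word: it is recurrent and, for every `n`, has `(d - 1) n + 1`
factors of length `n`, exactly one of them left special and exactly one right special. -/
def IsArnouxRauzy {d : ℕ} (u : InfWord d) : Prop :=
  IsRecurrent u ∧
    ∀ n : ℕ, {w | w ∈ language u ∧ w.length = n}.ncard = (d - 1) * n + 1 ∧
      (∃! w : List (Fin d), w.length = n ∧ IsLeftSpecial u w) ∧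
      (∃! w : List (Fin d), w.length = n ∧ IsRightSpecial u w)

/-- An Arnoux–Rauzy word all of whose prefixes are left special. -/
def IsStandard {d : ℕ} (u : InfWord d) : Prop :=
  IsArnouxRauzy u ∧ ∀ n : ℕ, IsLeftSpecial u (factorAt u 0 n)

/-- The elementary morphism `φ_i`: `i ↦ i`, and `j ↦ ij` for `j ≠ i`. -/
def elemMorphism {d : ℕ} (i : Fin d) (w : List (Fin d)) : List (Fin d) :=
  w.flatMap fun j => if j = i then [i] else [i, j]

/-- `y = φ_i(x) = φ_i(x_0) φ_i(x_1) φ_i(x_2) ⋯` for infinite words `x`, `y`: the image of each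
prefix of `x` is a prefix of `y` (these images get arbitrarily long, so they determine `y`). -/
def IsElemImage {d : ℕ} (i : Fin d) (x y : InfWord d) : Prop :=
  ∀ m : ℕ, factorAt y 0 (elemMorphism i (factorAt x 0 m)).length = elemMorphism i (factorAt x 0 m)

/-- `i` is a directive sequence of `v`: there are standard Arnoux–Rauzy words
`v = v⁽⁰⁾, v⁽¹⁾, v⁽²⁾, ...` with `v⁽ⁿ⁾ = φ_{i_n}(v⁽ⁿ⁺¹⁾)` for all `n`. -/
def IsDirectiveSequence {d : ℕ} (v : InfWord d) (i : ℕ → Fin d) : Prop :=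
  ∃ V : ℕ → InfWord d, V 0 = v ∧ (∀ n, IsStandard (V n)) ∧
    ∀ n, IsElemImage (i n) (V (n + 1)) (V n)

/-- `composite i m` is the composition `φ_{i_0} φ_{i_1} ⋯ φ_{i_{m-1}}` of `m` morphisms. -/
def composite {d : ℕ} (i : ℕ → Fin d) : ℕ → List (Fin d) → List (Fin d)
  | 0, w => w
  | m + 1, w => composite i m (elemMorphism (i m) w)

/-- `B_u(k)`: the bispecial factors of `u`, ordered by length and indexed from `0`. (`Nat.nth p`
lists increasingly the numbers satisfying `p`; an Arnoux–Rauzy word has at most one bispecial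
factor of each length.) -/
noncomputable def bispecial {d : ℕ} (u : InfWord d) (k : ℕ) : List (Fin d) :=
  Classical.epsilon fun w => IsBispecial u w ∧
    w.length = Nat.nth (fun m => ∃ v : List (Fin d), IsBispecial u v ∧ v.length = m) k

/-- `k` is an index with `|B_u(k-1)| < n ≤ |B_u(k)|`. -/
def IsLevel {d : ℕ} (u : InfWord d) (n k : ℕ) : Prop :=
  1 ≤ k ∧ (bispecial u (k - 1)).length < n ∧ n ≤ (bispecial u k).length

/-- `S_a(k) = sup {ℓ : 0 ≤ ℓ < k, i_ℓ = a}`, with `⊥` (that is, `-∞`) for the empty set. -/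
def lastOcc {d : ℕ} (i : ℕ → Fin d) (a : Fin d) (k : ℕ) : WithBot ℕ :=
  ((Finset.range k).filter fun l => i l = a).max

/-- `a ≠ i_k` and `S_a(k) = inf {S_b(k) : b ≠ i_k}`. -/
def IsExtremalLetter {d : ℕ} (i : ℕ → Fin d) (k : ℕ) (a : Fin d) : Prop :=
  a ≠ i k ∧ IsGLB {s | ∃ b : Fin d, b ≠ i k ∧ lastOcc i b k = s} (lastOcc i a k)

/-- The numbers `m` such that some `m` consecutive positions of `u` carry pairwise distinct
factors of length `n`. -/
def nonrepetitiveLengths {d : ℕ} (u : InfWord d) (n : ℕ) : Set ℕ :=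
  {m | ∃ k : ℕ, ∀ p q : ℕ, k ≤ p → p < q → q < k + m → factorAt u p n ≠ factorAt u q n}

/-- The non-repetitive complexity of `u`: the maximum of `nonrepetitiveLengths u n`. -/
noncomputable def nrC {d : ℕ} (u : InfWord d) (n : ℕ) : ℕ :=
  sSup (nonrepetitiveLengths u n)

end ArnouxRauzy

namespace ArnouxRauzy

variable {d : ℕ}

/-! ### Factors and languages -/

/-! Everything rests on cutting the standard word into blocks. Let `L_c` be the length of the image
of the letter `c` under the first `k` directive morphisms. The standard word is then a concatenation
of such images. From every block start one reads the same `|B(k)|` letters, and the next letter is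
the one that names the block.

Write `n = |B(k)| - D`. The level condition on `n` makes `D` smaller than every `L_c`. The factor of
length `n` at offset `s` of a block then depends only on `s` if `s ≤ D`, and only on `s` and the
block's letter otherwise. This leaves `(D + 1) + ∑ (L_c - (D + 1))` classes of positions. By
`sum_imageLength` this number is `(d - 1) n + 1`, the number of factors of length `n`, so distinct
classes carry distinct factors (`eq_of_factorAt_eq`). Repetitions are thus fully known. The same
fact identifies the bispecial factors as the prefixes of length `centralLength`.

A longest run without repetition starts at offset `D + 1` of a block of `i_k` and ends with the
following block of `a`, where `L_a` is maximal among letters other than `i_k`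
(`isGreatest_nonrepetitiveLengths`). Blocks are longer the earlier their letter was last used
(`imageLength_le_of_lastOcc_le`), which is why `a` is the extremal letter.

The expansion exists because specialness passes through `w ↦ φ_i(w) i`, so a standard word can be
desubstituted into a standard word. -/

@[simp]
theorem factorAt_length (u : InfWord d) (p n : ℕ) : (factorAt u p n).length = n := by
  simp [factorAt]

theorem factorAt_eq_iff {u v : InfWord d} {p q n : ℕ} :
    factorAt u p n = factorAt v q n ↔ ∀ t < n, u (p + t) = v (q + t) := by
  simp [factorAt, List.map_inj_left]

theorem factorAt_succ (u : InfWord d) (p n : ℕ) :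
    factorAt u p (n + 1) = factorAt u p n ++ [u (p + n)] := by
  simp [factorAt, List.range_succ]

theorem factorAt_add (u : InfWord d) (p m n : ℕ) :
    factorAt u p (m + n) = factorAt u p m ++ factorAt u (p + m) n := by
  induction n with
  | zero => simp [factorAt]
  | succ n ih => rw [← add_assoc, factorAt_succ, ih, factorAt_succ]; simp [add_assoc]

theorem factorAt_cons (u : InfWord d) (p n : ℕ) :
    factorAt u p (n + 1) = u p :: factorAt u (p + 1) n := by
  rw [add_comm, factorAt_add]; simp [factorAt]

theorem factorAt_mem (u : InfWord d) (p n : ℕ) : factorAt u p n ∈ language u := ⟨p, n, rfl⟩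

theorem mem_language_iff {u : InfWord d} {w : List (Fin d)} :
    w ∈ language u ↔ ∃ p, factorAt u p w.length = w := by
  constructor
  · rintro ⟨p, n, rfl⟩
    exact ⟨p, by simp⟩
  · rintro ⟨p, h⟩
    exact ⟨p, _, h⟩

theorem factorAt_append_eq_iff {u : InfWord d} {w z : List (Fin d)} {p : ℕ} :
    factorAt u p (w ++ z).length = w ++ z ↔
      factorAt u p w.length = w ∧ factorAt u (p + w.length) z.length = z := by
  rw [List.length_append, factorAt_add]
  constructor
  · intro h
    exact List.append_inj h (by simp)
  · rintro ⟨h1, h2⟩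
    rw [h1, h2]

theorem factorAt_singleton_eq_iff {u : InfWord d} {a : Fin d} {p : ℕ} :
    factorAt u p [a].length = [a] ↔ u p = a := by
  simp [factorAt]

theorem factorAt_cons_eq_iff {u : InfWord d} {a : Fin d} {w : List (Fin d)} {p : ℕ} :
    factorAt u p (a :: w).length = a :: w ↔ u p = a ∧ factorAt u (p + 1) w.length = w := by
  rw [List.length_cons, factorAt_cons, List.cons.injEq]

theorem append_mem_language_iff {u : InfWord d} {w : List (Fin d)} {a : Fin d} :
    w ++ [a] ∈ language u ↔ ∃ p, factorAt u p w.length = w ∧ u (p + w.length) = a := by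
  simp only [mem_language_iff, factorAt_append_eq_iff, factorAt_singleton_eq_iff]

theorem cons_mem_language_iff {u : InfWord d} {w : List (Fin d)} {a : Fin d} :
    a :: w ∈ language u ↔ ∃ p, u p = a ∧ factorAt u (p + 1) w.length = w := by
  simp only [mem_language_iff, factorAt_cons_eq_iff]

theorem left_mem_language {u : InfWord d} {w z : List (Fin d)} (h : w ++ z ∈ language u) :
    w ∈ language u := by
  obtain ⟨p, hp⟩ := mem_language_iff.1 h
  exact mem_language_iff.2 ⟨p, (factorAt_append_eq_iff.1 hp).1⟩

theorem right_mem_language {u : InfWord d} {w z : List (Fin d)} (h : w ++ z ∈ language u) :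
    z ∈ language u := by
  obtain ⟨p, hp⟩ := mem_language_iff.1 h
  exact mem_language_iff.2 ⟨_, (factorAt_append_eq_iff.1 hp).2⟩

theorem IsLeftSpecial.left {u : InfWord d} {w z : List (Fin d)} (h : IsLeftSpecial u (w ++ z)) :
    IsLeftSpecial u w := by
  obtain ⟨a, b, hab, ha, hb⟩ := h
  exact ⟨a, b, hab, left_mem_language (z := z) ha, left_mem_language (z := z) hb⟩

theorem IsRightSpecial.right {u : InfWord d} {w z : List (Fin d)}
    (h : IsRightSpecial u (w ++ z)) : IsRightSpecial u z := by
  obtain ⟨a, b, hab, ha, hb⟩ := h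
  rw [List.append_assoc] at ha hb
  exact ⟨a, b, hab, right_mem_language ha, right_mem_language hb⟩

theorem IsLeftSpecial.mem {u : InfWord d} {w : List (Fin d)} (h : IsLeftSpecial u w) :
    w ∈ language u := by
  obtain ⟨a, b, hab, ha, hb⟩ := h
  exact right_mem_language (w := [a]) ha

theorem IsRightSpecial.mem {u : InfWord d} {w : List (Fin d)} (h : IsRightSpecial u w) :
    w ∈ language u := by
  obtain ⟨a, b, hab, ha, hb⟩ := h
  exact left_mem_language ha

theorem exists_later_occurrence {u : InfWord d} (hu : IsRecurrent u) (p n : ℕ) :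
    ∃ q, p < q ∧ factorAt u q n = factorAt u p n := by
  obtain ⟨a, b, hab, -, hb⟩ := hu (factorAt u 0 (p + n)) (factorAt_mem _ _ _)
  rw [factorAt_length] at hb
  refine ⟨b + p, by omega, factorAt_eq_iff.2 fun t ht => ?_⟩
  have := factorAt_eq_iff.1 hb (p + t) (by omega)
  rwa [zero_add, ← add_assoc] at this

/-! ### Counting right extensions -/

theorem finite_factors (u : InfWord d) (n : ℕ) :
    {w | w ∈ language u ∧ w.length = n}.Finite :=
  (List.finite_length_eq (Fin d) n).subset fun _ h => h.2

/-- Deleting the last letter is injective on the extensions of factors other than `w`, since these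
are not right special. Only `w` contributes more than one extension. -/
theorem ncard_factors_succ {u : InfWord d} {n : ℕ} {w : List (Fin d)} (hw : w.length = n)
    (hrs : IsRightSpecial u w)
    (huniq : ∀ z : List (Fin d), z.length = n → IsRightSpecial u z → z = w) :
    {z | z ∈ language u ∧ z.length = n + 1}.ncard + 1 =
      {z | z ∈ language u ∧ z.length = n}.ncard + {a | w ++ [a] ∈ language u}.ncard := by
  have hfin := finite_factors u (n + 1)
  have hsplit : {z | z ∈ language u ∧ z.length = n + 1} =
      {z | z ∈ language u ∧ z.length = n + 1 ∧ z.dropLast ≠ w} ∪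
        (fun a => w ++ [a]) '' {a | w ++ [a] ∈ language u} := by
    ext z
    simp only [Set.mem_ofPred_eq, Set.mem_union, Set.mem_image]
    constructor
    · rintro ⟨h1, h2⟩
      by_cases h : z.dropLast = w
      · right
        have hne : z ≠ [] := by rintro rfl; simp at h2
        have := List.dropLast_append_getLast hne
        rw [h] at this
        exact ⟨z.getLast hne, by rwa [this], this⟩
      · exact Or.inl ⟨h1, h2, h⟩
    · rintro (⟨h1, h2, -⟩ | ⟨a, ha, rfl⟩)
      · exact ⟨h1, h2⟩
      · exact ⟨ha, by simp [hw]⟩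
  have hdisj : Disjoint {z | z ∈ language u ∧ z.length = n + 1 ∧ z.dropLast ≠ w}
      ((fun a => w ++ [a]) '' {a | w ++ [a] ∈ language u}) := by
    rw [Set.disjoint_left]
    rintro z ⟨-, -, hz⟩ ⟨a, -, rfl⟩
    simp at hz
  have hfin1 : {z | z ∈ language u ∧ z.length = n + 1 ∧ z.dropLast ≠ w}.Finite :=
    hfin.subset fun z hz => ⟨hz.1, hz.2.1⟩
  have himg : List.dropLast '' {z | z ∈ language u ∧ z.length = n + 1 ∧ z.dropLast ≠ w} =
      {z | z ∈ language u ∧ z.length = n} \ {w} := by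
    ext z
    simp only [Set.mem_image, Set.mem_ofPred_eq, Set.mem_sdiff, Set.mem_singleton_iff]
    constructor
    · rintro ⟨y, ⟨h1, h2, h3⟩, rfl⟩
      have hne : y ≠ [] := by rintro rfl; simp at h2
      refine ⟨⟨?_, by simp [h2]⟩, h3⟩
      rw [← List.dropLast_append_getLast hne] at h1
      exact left_mem_language h1
    · rintro ⟨⟨h1, h2⟩, h3⟩
      obtain ⟨p, hp⟩ := mem_language_iff.1 h1
      exact ⟨z ++ [u (p + z.length)],
        ⟨append_mem_language_iff.2 ⟨p, hp, rfl⟩, by simp [h2], by simpa using h3⟩, by simp⟩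
  have hinj : Set.InjOn List.dropLast
      {z | z ∈ language u ∧ z.length = n + 1 ∧ z.dropLast ≠ w} := by
    rintro x ⟨hx1, hx2, hx3⟩ y ⟨hy1, hy2, -⟩ hxy
    have hnx : x ≠ [] := by rintro rfl; simp at hx2
    have hny : y ≠ [] := by rintro rfl; simp at hy2
    have ex := List.dropLast_append_getLast hnx
    have ey := List.dropLast_append_getLast hny
    by_contra hne
    apply hx3
    refine huniq _ (by simp [hx2]) ⟨x.getLast hnx, y.getLast hny, ?_, by rwa [ex], ?_⟩
    · intro hl
      apply hne
      rw [← ex, ← ey, hxy, hl]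
    · rw [hxy]
      rwa [ey]
  have hc1 : {z | z ∈ language u ∧ z.length = n + 1 ∧ z.dropLast ≠ w}.ncard + 1 =
      {z | z ∈ language u ∧ z.length = n}.ncard := by
    rw [← hinj.ncard_image, himg]
    exact Set.ncard_sdiff_singleton_add_one ⟨hrs.mem, hw⟩ (finite_factors u n)
  have hc2 : ((fun a => w ++ [a]) '' {a | w ++ [a] ∈ language u}).ncard =
      {a | w ++ [a] ∈ language u}.ncard :=
    Set.ncard_image_of_injective _ fun a b h => by simpa using h
  rw [hsplit, Set.ncard_union_eq hdisj hfin1 (Set.toFinite _), hc2]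
  omega

theorem IsArnouxRauzy.two_le {u : InfWord d} (hu : IsArnouxRauzy u) : 2 ≤ d := by
  obtain ⟨-, ⟨w, ⟨-, a, b, hab, -⟩, -⟩, -⟩ := hu.2 0
  by_contra h
  have : a.1 = b.1 := by omega
  exact hab (Fin.ext this)

/-- The complexity grows by `d - 1` at each length, and the single right special factor must account
for all of it. -/
theorem IsArnouxRauzy.append_mem {u : InfWord d} (hu : IsArnouxRauzy u) {w : List (Fin d)}
    (hw : IsRightSpecial u w) (a : Fin d) : w ++ [a] ∈ language u := by
  obtain ⟨h1, -, h2⟩ := hu.2 w.length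
  have h3 := (hu.2 (w.length + 1)).1
  have := ncard_factors_succ rfl hw fun z hz hz' => h2.unique ⟨hz, hz'⟩ ⟨rfl, hw⟩
  rw [h1, h3, mul_add] at this
  have hd := hu.two_le
  have hc : {a | w ++ [a] ∈ language u}.ncard = d := by omega
  have : {a | w ++ [a] ∈ language u} = Set.univ := by
    apply Set.eq_of_subset_of_ncard_le (Set.subset_univ _) _ Set.finite_univ
    rw [Set.ncard_univ, Nat.card_eq_fintype_card, Fintype.card_fin, hc]
  exact this.ge (Set.mem_univ a)

theorem IsArnouxRauzy.exists_eq {u : InfWord d} (hu : IsArnouxRauzy u) (a : Fin d) :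
    ∃ p, u p = a := by
  obtain ⟨w, ⟨hw, hrs⟩, -⟩ := (hu.2 0).2.2
  obtain rfl := List.length_eq_zero_iff.1 hw
  obtain ⟨p, -, hp⟩ := append_mem_language_iff.1 (hu.append_mem hrs a)
  exact ⟨_, hp⟩

theorem IsStandard.eq_prefix {v : InfWord d} (hv : IsStandard v) {w : List (Fin d)}
    (hw : IsLeftSpecial v w) : w = factorAt v 0 w.length :=
  (hv.1.2 w.length).2.1.unique ⟨rfl, hw⟩ ⟨by simp, hv.2 _⟩

/-! ### The standard word with a given language -/

/-- A purely periodic word has at most `P` factors of length `P`, fewer than `(d - 1) P + 1`. -/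
theorem IsArnouxRauzy.not_periodic {u : InfWord d} (hu : IsArnouxRauzy u) {P : ℕ} (hP : 0 < P)
    (h : ∀ t, u (t + P) = u t) : False := by
  have hsub : {w | w ∈ language u ∧ w.length = P} ⊆
      (fun p => factorAt u p P) '' (Finset.range P : Set ℕ) := by
    rintro _ ⟨⟨p, n, rfl⟩, hn⟩
    rw [factorAt_length] at hn
    subst hn
    refine ⟨p % n, by simpa using Nat.mod_lt _ hP, factorAt_eq_iff.2 fun t _ => ?_⟩
    have hper : Function.Periodic u n := h
    conv_rhs => rw [← hper.map_mod_nat]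
    conv_lhs => rw [← hper.map_mod_nat]
    simp
  have h1 := Set.ncard_le_ncard hsub (Set.toFinite _)
  rw [(hu.2 P).1] at h1
  have h2 := Set.ncard_image_le (f := fun p => factorAt u p P) (Finset.range P).finite_toSet
  rw [Set.ncard_coe_finset, Finset.card_range] at h2
  have hd := hu.two_le
  have : 1 * P ≤ (d - 1) * P := Nat.mul_le_mul_right _ (by omega)
  omega

/-- Otherwise `w` determines everything to its left. Two occurrences of `w` would then force the
whole word to be periodic. -/
theorem IsArnouxRauzy.exists_leftSpecial_append {u : InfWord d} (hu : IsArnouxRauzy u)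
    {w : List (Fin d)} (hw : w ∈ language u) : ∃ x, IsLeftSpecial u (x ++ w) := by
  by_contra! hno
  have key : ∀ m a b, factorAt u (a + m) w.length = w → factorAt u (b + m) w.length = w →
      factorAt u a (m + w.length) = factorAt u b (m + w.length) := by
    intro m
    induction m with
    | zero => intro a b ha hb; simp only [add_zero, zero_add] at *; rw [ha, hb]
    | succ m ih =>
      intro a b ha hb
      have h1 := ih (a + 1) (b + 1) (by rwa [add_right_comm, add_assoc])
        (by rwa [add_right_comm, add_assoc])
      rw [add_right_comm, factorAt_cons, factorAt_cons, h1]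
      congr 1
      by_contra hne
      apply hno (factorAt u (b + 1) m)
      have hb' : factorAt u (b + 1) m ++ w = factorAt u (b + 1) (m + w.length) := by
        rw [factorAt_add]
        congr 1
        rw [show b + 1 + m = b + (m + 1) by omega, hb]
      refine ⟨u a, u b, hne, ?_, ?_⟩
      · rw [hb', ← h1, ← factorAt_cons]
        exact factorAt_mem _ _ _
      · rw [hb', ← factorAt_cons]
        exact factorAt_mem _ _ _
  obtain ⟨p, q, hpq, hp, hq⟩ := hu.1 w hw
  obtain ⟨P, rfl⟩ := Nat.exists_eq_add_of_lt hpq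
  have hlarge : ∀ N, ∃ r, N ≤ r ∧ factorAt u r w.length = w := by
    intro N
    induction N with
    | zero => exact ⟨p, by omega, hp⟩
    | succ N ih =>
      obtain ⟨r, hr, h⟩ := ih
      obtain ⟨s, hs, h'⟩ := exists_later_occurrence hu.1 r w.length
      exact ⟨s, by omega, h'.trans h⟩
  refine hu.not_periodic (P := P + 1) (by omega) fun t => ?_
  obtain ⟨r, hr, hrw⟩ := hlarge (t + p + P + 1)
  obtain ⟨s, rfl⟩ := Nat.exists_eq_add_of_le hr
  have hmove : ∀ {a b}, a = b → factorAt u a w.length = w → factorAt u b w.length = w := by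
    rintro a _ rfl h
    exact h
  -- Both `r` and `q` are occurrences of `w`, so their pasts agree; stepping back by `P + 1 = q - p`
  -- from `r` therefore gives `w` again. Comparing the pasts of these two late occurrences yields
  -- the period at `t`.
  have h1 := factorAt_eq_iff.1 (key (P + 1) (t + p + s) p (hmove (by omega) hrw) hq)
  have h2 : factorAt u (t + p + s) w.length = w :=
    (factorAt_eq_iff.2 fun t' ht' => h1 t' (by omega)).trans hp
  have h3 : factorAt u t (p + s + w.length) = factorAt u (t + P + 1) (p + s + w.length) :=
    key (p + s) t (t + P + 1) (hmove (by omega) h2) (hmove (by omega) hrw)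
  have h4 : 0 < p + s + w.length → u (t + (P + 1)) = u t := fun h0 => by
    simpa [add_assoc] using (factorAt_eq_iff.1 h3 0 h0).symm
  rcases Nat.eq_zero_or_pos w.length with h0 | h0
  · have h5 : ∀ a, factorAt u a w.length = w := fun a => by
      rw [List.length_eq_zero_iff.1 h0]
      rfl
    simpa [add_assoc] using
      (factorAt_eq_iff.1 (key 1 t (t + P + 1) (h5 _) (h5 _)) 0 (by omega)).symm
  · exact h4 (by omega)

theorem isLeftSpecial_congr {u v : InfWord d} (h : language v = language u) (w : List (Fin d)) :
    IsLeftSpecial v w ↔ IsLeftSpecial u w := by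
  simp only [IsLeftSpecial, h]

theorem isRightSpecial_congr {u v : InfWord d} (h : language v = language u)
    (w : List (Fin d)) : IsRightSpecial v w ↔ IsRightSpecial u w := by
  simp only [IsRightSpecial, h]

theorem isBispecial_congr {u v : InfWord d} (h : language v = language u) (w : List (Fin d)) :
    IsBispecial v w ↔ IsBispecial u w := by
  simp only [IsBispecial, isLeftSpecial_congr h, isRightSpecial_congr h]

theorem IsRecurrent.congr {u v : InfWord d} (hu : IsRecurrent u)
    (h : language v = language u) : IsRecurrent v := by
  intro w hw
  rw [h] at hw
  obtain ⟨p, q, hpq, hp, hq⟩ := hu w hw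
  have := factorAt_mem u p (q - p + w.length)
  rw [← h, mem_language_iff, factorAt_length] at this
  obtain ⟨r, hr⟩ := this
  refine ⟨r, r + (q - p), by omega, ?_, ?_⟩
  · rw [← hp, factorAt_length]
    rw [factorAt_eq_iff] at hr ⊢
    exact fun t ht => hr t (by omega)
  · rw [← hq, factorAt_length]
    rw [factorAt_eq_iff] at hr ⊢
    intro t ht
    have := hr (q - p + t) (by omega)
    rwa [← add_assoc, ← add_assoc, show p + (q - p) = q by omega] at this

theorem IsArnouxRauzy.congr {u v : InfWord d} (hu : IsArnouxRauzy u)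
    (h : language v = language u) : IsArnouxRauzy v := by
  refine ⟨hu.1.congr h, fun n => ?_⟩
  simp only [isLeftSpecial_congr h, isRightSpecial_congr h, h]
  exact hu.2 n

/-- The left special factors are prefixes of one another, so they converge to an infinite word. It
has every factor of `u`, because each extends to the left to a left special one. -/
theorem IsArnouxRauzy.existsUnique_standard {u : InfWord d} (hu : IsArnouxRauzy u) :
    ∃! v : InfWord d, IsStandard v ∧ language v = language u := by
  choose l hl hluniq using fun n => (hu.2 n).2.1
  have hne : ∀ n, l (n + 1) ≠ [] := fun n h => by
    have := (hl (n + 1)).1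
    rw [h] at this
    simp at this
  have hpre : ∀ n, (l (n + 1)).dropLast = l n := fun n => by
    apply hluniq
    refine ⟨by simp [(hl (n + 1)).1], ?_⟩
    have h := (hl (n + 1)).2
    rw [← List.dropLast_append_getLast (hne n)] at h
    exact h.left
  let v : InfWord d := fun n => (l (n + 1)).getLast (hne n)
  have hv : ∀ n, factorAt v 0 n = l n := by
    intro n
    induction n with
    | zero =>
      have := List.length_eq_zero_iff.1 (hl 0).1
      rw [this]
      simp [factorAt]
    | succ n ih =>
      rw [factorAt_succ, ih, zero_add, ← hpre n]
      exact List.dropLast_append_getLast (hne n)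
  have hlang : language v = language u := by
    apply Set.Subset.antisymm
    · rintro _ ⟨p, n, rfl⟩
      have := (hl (p + n)).2.mem
      rw [← hv, factorAt_add, zero_add] at this
      exact right_mem_language this
    · intro w hw
      obtain ⟨x, hx⟩ := hu.exists_leftSpecial_append hw
      have : x ++ w = factorAt v 0 (x ++ w).length := by
        rw [hv]
        exact hluniq _ _ ⟨rfl, hx⟩
      exact right_mem_language (w := x) (this ▸ factorAt_mem _ _ _)
  refine ⟨v, ⟨⟨hu.congr hlang, fun n => ?_⟩, hlang⟩, ?_⟩
  · rw [isLeftSpecial_congr hlang, hv]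
    exact (hl n).2
  · rintro x ⟨hx, hxl⟩
    funext n
    have h1 : factorAt x 0 (n + 1) = factorAt v 0 (n + 1) := by
      rw [hv]
      exact hluniq _ _ ⟨by simp, (isLeftSpecial_congr hxl _).1 (hx.2 _)⟩
    simpa using factorAt_eq_iff.1 h1 n (by omega)

/-! ### Elementary morphisms on infinite words -/

/-- The position in `φ_i(x)` at which the image of the letter `x_j` starts. -/
def blockStart (i : Fin d) (x : InfWord d) : ℕ → ℕ
  | 0 => 0
  | j + 1 => blockStart i x j + if x j = i then 1 else 2

theorem elemMorphism_append (i : Fin d) (w z : List (Fin d)) :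
    elemMorphism i (w ++ z) = elemMorphism i w ++ elemMorphism i z := by
  simp [elemMorphism]

theorem elemMorphism_cons (i a : Fin d) (z : List (Fin d)) :
    elemMorphism i (a :: z) = (if a = i then [i] else [i, a]) ++ elemMorphism i z := by
  simp [elemMorphism]

theorem elemMorphism_singleton (i a : Fin d) :
    elemMorphism i [a] = if a = i then [i] else [i, a] := by
  simp [elemMorphism]

theorem length_elemMorphism_factorAt (i : Fin d) (x : InfWord d) (m : ℕ) :
    (elemMorphism i (factorAt x 0 m)).length = blockStart i x m := by
  induction m with
  | zero => rfl
  | succ m ih =>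
    rw [factorAt_succ, elemMorphism_append, List.length_append, ih, elemMorphism_singleton,
      zero_add, blockStart]
    split_ifs <;> rfl

theorem strictMono_blockStart (i : Fin d) (x : InfWord d) : StrictMono (blockStart i x) :=
  strictMono_nat_of_lt_succ fun j => by
    rw [blockStart]
    split_ifs <;> omega

theorem blockStart_add_le (i : Fin d) (x : InfWord d) (j n : ℕ) :
    blockStart i x (j + n) ≤ blockStart i x j + 2 * n := by
  induction n with
  | zero => simp
  | succ n ih =>
    rw [← add_assoc, blockStart]
    split_ifs <;> omega

theorem eq_blockStart_or (i : Fin d) (x : InfWord d) (p : ℕ) : ∃ j, p = blockStart i x j ∨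
    (p = blockStart i x j + 1 ∧ x j ≠ i) := by
  induction p with
  | zero => exact ⟨0, Or.inl rfl⟩
  | succ p ih =>
    obtain ⟨j, rfl | ⟨rfl, hj⟩⟩ := ih
    · by_cases hj : x j = i
      · exact ⟨j + 1, Or.inl (by rw [blockStart, if_pos hj])⟩
      · exact ⟨j, Or.inr ⟨rfl, hj⟩⟩
    · exact ⟨j + 1, Or.inl (by rw [blockStart, if_neg hj])⟩

theorem isElemImage_iff {i : Fin d} {x y : InfWord d} :
    IsElemImage i x y ↔
      ∀ j, y (blockStart i x j) = i ∧ (x j ≠ i → y (blockStart i x j + 1) = x j) := by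
  have hstep : ∀ j, factorAt y 0 (elemMorphism i (factorAt x 0 (j + 1))).length =
      elemMorphism i (factorAt x 0 (j + 1)) ↔
      factorAt y 0 (elemMorphism i (factorAt x 0 j)).length = elemMorphism i (factorAt x 0 j) ∧
        y (blockStart i x j) = i ∧ (x j ≠ i → y (blockStart i x j + 1) = x j) := by
    intro j
    rw [factorAt_succ, elemMorphism_append, factorAt_append_eq_iff,
      length_elemMorphism_factorAt, zero_add, zero_add, elemMorphism_singleton]
    by_cases h : x j = i
    · simp [h, factorAt]
    · simp [h, factorAt, List.range_succ]
  constructor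
  · intro h j
    exact ((hstep j).1 (h (j + 1))).2
  · intro h m
    induction m with
    | zero => rfl
    | succ m ih => exact (hstep m).2 ⟨ih, h m⟩

namespace IsElemImage

variable {i : Fin d} {x y : InfWord d}

theorem apply_blockStart (h : IsElemImage i x y) (j : ℕ) : y (blockStart i x j) = i := (isElemImage_iff.1 h j).1

/-- Uniform in both cases: if the block is the single letter `i`, the next block starts with `i`,
which is again `x j`. -/
theorem apply_blockStart_add_one (h : IsElemImage i x y) (j : ℕ) : y (blockStart i x j + 1) = x j := by
  by_cases hj : x j = i
  · have := h.apply_blockStart (j + 1)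
    rw [blockStart, if_pos hj] at this
    rw [this, hj]
  · exact (isElemImage_iff.1 h j).2 hj

theorem apply_of_add_one_eq (h : IsElemImage i x y) {p j : ℕ} (hp : p + 1 = blockStart i x (j + 1)) : y p = x j := by
  rw [blockStart] at hp
  split_ifs at hp with hj
  · rw [show p = blockStart i x j by omega, h.apply_blockStart, hj]
  · rw [show p = blockStart i x j + 1 by omega, h.apply_blockStart_add_one]

theorem exists_eq_blockStart (h : IsElemImage i x y) {p : ℕ} (hp : y p = i) : ∃ j, p = blockStart i x j := by
  obtain ⟨j, hj | ⟨rfl, hj⟩⟩ := eq_blockStart_or i x p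
  · exact ⟨j, hj⟩
  · rw [h.apply_blockStart_add_one] at hp
    exact absurd hp hj

theorem image_occurs (h : IsElemImage i x y) {w : List (Fin d)} {j : ℕ} (hw : factorAt x j w.length = w) :
    factorAt y (blockStart i x j) (elemMorphism i w ++ [i]).length = elemMorphism i w ++ [i] ∧
      blockStart i x (j + w.length) = blockStart i x j + (elemMorphism i w).length := by
  induction w generalizing j with
  | nil => simpa [elemMorphism, factorAt] using h.apply_blockStart j
  | cons a w ih =>
    obtain ⟨ha, hw⟩ := factorAt_cons_eq_iff.1 hw
    obtain ⟨h1, h2⟩ := ih hw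
    rw [elemMorphism_cons, List.append_assoc, factorAt_append_eq_iff, List.length_cons,
      add_comm w.length, ← add_assoc, h2, blockStart,
      List.length_append (bs := elemMorphism i w), ha]
    rw [blockStart, ha] at h1
    have h3 := h.apply_blockStart j
    have h4 := h.apply_blockStart_add_one j
    rw [ha] at h4
    split_ifs with hai
    · rw [if_pos hai] at h1
      simp only [List.length_singleton]
      exact ⟨⟨by simpa [factorAt] using h3, h1⟩, by omega⟩
    · rw [if_neg hai] at h1
      simp only [List.length_cons, List.length_nil, zero_add, Nat.reduceAdd]
      exact ⟨⟨by simp [factorAt, List.range_succ, h3, h4], h1⟩, by omega⟩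

/-- The letter `i` occurs exactly at block starts, so an occurrence can be cut in only one way. The
closing `i` guarantees that the last block is complete. -/
theorem exists_of_image_occurs (h : IsElemImage i x y) {w : List (Fin d)} {p : ℕ}
    (hp : factorAt y p (elemMorphism i w ++ [i]).length = elemMorphism i w ++ [i]) :
    ∃ j, p = blockStart i x j ∧ factorAt x j w.length = w := by
  induction w generalizing p with
  | nil =>
    obtain ⟨j, hj⟩ := h.exists_eq_blockStart (p := p) (by simpa [elemMorphism, factorAt] using hp)
    exact ⟨j, hj, rfl⟩
  | cons a w ih =>
    rw [elemMorphism_cons, List.append_assoc, factorAt_append_eq_iff] at hp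
    obtain ⟨hp1, hp2⟩ := hp
    obtain ⟨j', hj', hw⟩ := ih hp2
    have hpi : y p = i := by
      split_ifs at hp1
      · simpa [factorAt] using hp1
      · simp [factorAt, List.range_succ] at hp1
        exact hp1.1
    obtain ⟨j, rfl⟩ := h.exists_eq_blockStart hpi
    have hxj := h.apply_blockStart_add_one j
    have ha : x j = a := by
      rw [← hxj]
      split_ifs at hp1 hj' with hai
      · rw [List.length_singleton] at hj'
        rw [hj', h.apply_blockStart, hai]
      · simp [factorAt, List.range_succ] at hp1
        exact hp1.2
    have hjj : j' = j + 1 := by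
      apply (strictMono_blockStart i x).injective
      rw [← hj', blockStart, ha]
      split_ifs <;> rfl
    subst hjj
    exact ⟨j, rfl, factorAt_cons_eq_iff.2 ⟨ha, hw⟩⟩

/-- The image of a letter ends with that letter, so what precedes an image is what preceded the
original factor. -/
theorem cons_mem_iff (h : IsElemImage i x y) {a : Fin d} {w : List (Fin d)} :
    a :: w ∈ language x ↔ a :: (elemMorphism i w ++ [i]) ∈ language y := by
  rw [cons_mem_language_iff, cons_mem_language_iff]
  constructor
  · rintro ⟨j, rfl, hw⟩
    obtain ⟨p, hp⟩ : ∃ p, p + 1 = blockStart i x (j + 1) :=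
      ⟨blockStart i x (j + 1) - 1, by
        have := lt_of_le_of_lt (Nat.zero_le _) (strictMono_blockStart i x (Nat.lt_succ_self j))
        simp only [Nat.succ_eq_add_one] at this
        omega⟩
    exact ⟨p, h.apply_of_add_one_eq hp, hp ▸ (h.image_occurs hw).1⟩
  · rintro ⟨p, rfl, hw⟩
    obtain ⟨j, hj, hw'⟩ := h.exists_of_image_occurs hw
    cases j with
    | zero => simp [blockStart] at hj
    | succ j => exact ⟨j, (h.apply_of_add_one_eq hj).symm, hw'⟩

theorem append_mem_iff (h : IsElemImage i x y) {a : Fin d} {w : List (Fin d)} :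
    w ++ [a] ∈ language x ↔ (elemMorphism i w ++ [i]) ++ [a] ∈ language y := by
  have key : ∀ j, factorAt x j w.length = w →
      y (blockStart i x j + (elemMorphism i w ++ [i]).length) = x (j + w.length) := by
    intro j hw
    rw [List.length_append, ← add_assoc, ← (h.image_occurs hw).2]
    exact h.apply_blockStart_add_one _
  rw [append_mem_language_iff, append_mem_language_iff]
  constructor
  · rintro ⟨j, hw, rfl⟩
    exact ⟨_, (h.image_occurs hw).1, key j hw⟩
  · rintro ⟨p, hw, rfl⟩
    obtain ⟨j, rfl, hw'⟩ := h.exists_of_image_occurs hw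
    exact ⟨j, hw', (key j hw').symm⟩

theorem isLeftSpecial_iff (h : IsElemImage i x y) {w : List (Fin d)} :
    IsLeftSpecial x w ↔ IsLeftSpecial y (elemMorphism i w ++ [i]) := by
  simp only [IsLeftSpecial, h.cons_mem_iff]

theorem isRightSpecial_iff (h : IsElemImage i x y) {w : List (Fin d)} :
    IsRightSpecial x w ↔ IsRightSpecial y (elemMorphism i w ++ [i]) := by
  simp only [IsRightSpecial, h.append_mem_iff]

theorem isRecurrent (h : IsElemImage i x y) (hy : IsRecurrent y) : IsRecurrent x := by
  intro w hw
  obtain ⟨j, hj⟩ := mem_language_iff.1 hw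
  obtain ⟨p, q, hpq, hp, hq⟩ := hy _ (mem_language_iff.2 ⟨_, (h.image_occurs hj).1⟩)
  obtain ⟨a, rfl, ha⟩ := h.exists_of_image_occurs hp
  obtain ⟨b, rfl, hb⟩ := h.exists_of_image_occurs hq
  exact ⟨a, b, (strictMono_blockStart i x).lt_iff_lt.1 hpq, ha, hb⟩

theorem isLeftSpecial_prefix (h : IsElemImage i x y) (hy : IsStandard y) (n : ℕ) : IsLeftSpecial x (factorAt x 0 n) := by
  rw [h.isLeftSpecial_iff]
  have h1 := (h.image_occurs (w := factorAt x 0 n) (j := 0) (by rw [factorAt_length])).1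
  rw [← h1]
  exact hy.2 _

theorem eq_prefix_of_isLeftSpecial (h : IsElemImage i x y) (hy : IsStandard y) {w : List (Fin d)}
    (hw : IsLeftSpecial x w) : w = factorAt x 0 w.length := by
  obtain ⟨j, hj, hw'⟩ := h.exists_of_image_occurs (p := 0)
    (hy.eq_prefix (h.isLeftSpecial_iff.1 hw)).symm
  obtain rfl : j = 0 := (strictMono_blockStart i x).injective hj.symm
  exact hw'.symm

/-- In `y`, the shorter image is a suffix of the longer one by uniqueness. Their right ends
coincide, so desubstitution gives suffixes of equal length of the same factor. -/
theorem isRightSpecial_unique (h : IsElemImage i x y) (hy : IsArnouxRauzy y) {w z : List (Fin d)}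
    (hlen : w.length = z.length) (hw : IsRightSpecial x w) (hz : IsRightSpecial x z) :
    w = z := by
  wlog hle : (elemMorphism i w).length ≤ (elemMorphism i z).length generalizing w z
  · exact (this hlen.symm hz hw (le_of_not_ge hle)).symm
  rw [h.isRightSpecial_iff] at hw hz
  obtain ⟨p, hp⟩ := mem_language_iff.1 hz.mem
  obtain ⟨j, rfl, hjz⟩ := h.exists_of_image_occurs hp
  obtain ⟨m, hm⟩ := Nat.exists_eq_add_of_le hle
  rw [show (elemMorphism i z ++ [i]).length = m + (elemMorphism i w ++ [i]).length by
    simp; omega, factorAt_add] at hp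
  have hsuf := hz
  rw [← hp] at hsuf
  have heq := (hy.2 _).2.2.unique ⟨rfl, hw⟩ ⟨by rw [factorAt_length], hsuf.right⟩
  obtain ⟨j', hj', hw'⟩ := h.exists_of_image_occurs heq.symm
  have e1 := (h.image_occurs hjz).2
  have e2 := (h.image_occurs hw').2
  have e3 : j + z.length = j' + w.length := by
    apply (strictMono_blockStart i x).injective
    omega
  obtain rfl : j = j' := by omega
  rw [← hw', ← hjz, hlen]

theorem exists_isRightSpecial (h : IsElemImage i x y) (hy : IsArnouxRauzy y) (hri : IsRightSpecial y [i]) (n : ℕ) :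
    ∃ w, w.length = n ∧ IsRightSpecial x w := by
  -- Length `2 * n + 1` suffices: `n` blocks occupy at most `2 * n` letters, and one more is needed
  -- for the closing `i`.
  obtain ⟨r, ⟨hr, hrs⟩, -⟩ := (hy.2 (2 * n + 1)).2.2
  obtain ⟨p, hp⟩ := mem_language_iff.1 hrs.mem
  rw [hr, factorAt_succ] at hp
  have hlast : y (p + 2 * n) = i := by
    rw [← hp] at hrs
    have := (hy.2 1).2.2.unique ⟨rfl, hri⟩ ⟨rfl, hrs.right⟩
    simpa using this.symm
  obtain ⟨m, hm⟩ := h.exists_eq_blockStart hlast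
  have hnm : n ≤ m := by
    have := blockStart_add_le i x 0 m
    rw [zero_add, ← hm, blockStart] at this
    omega
  obtain ⟨j, rfl⟩ := Nat.exists_eq_add_of_le' hnm
  have hle := blockStart_add_le i x j n
  refine ⟨factorAt x j n, by simp, ?_⟩
  obtain ⟨h1, h2⟩ := h.image_occurs (w := factorAt x j n) (j := j) (by rw [factorAt_length])
  rw [factorAt_length] at h2
  rw [h.isRightSpecial_iff, ← h1]
  obtain ⟨s, hs⟩ := Nat.exists_eq_add_of_le (show p ≤ blockStart i x j by omega)
  have e1 : factorAt y p (2 * n + 1) = factorAt y p s ++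
      factorAt y (blockStart i x j) (elemMorphism i (factorAt x j n) ++ [i]).length := by
    rw [hs, ← factorAt_add]
    congr 1
    rw [List.length_append, List.length_singleton]
    omega
  rw [← factorAt_succ, e1] at hp
  rw [← hp] at hrs
  exact hrs.right

theorem isStandard (h : IsElemImage i x y) (hy : IsStandard y) (hri : IsRightSpecial y [i]) : IsStandard x := by
  have hL : ∀ n, ∃! w : List (Fin d), w.length = n ∧ IsLeftSpecial x w := fun n =>
    ⟨factorAt x 0 n, ⟨by simp, h.isLeftSpecial_prefix hy n⟩, by
      rintro w ⟨rfl, hw⟩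
      exact h.eq_prefix_of_isLeftSpecial hy hw⟩
  have hR : ∀ n, ∃! w : List (Fin d), w.length = n ∧ IsRightSpecial x w := fun n => by
    obtain ⟨w, hw, hrs⟩ := h.exists_isRightSpecial hy.1 hri n
    exact ⟨w, ⟨hw, hrs⟩, fun z hz => h.isRightSpecial_unique hy.1 (hz.1.trans hw.symm) hz.2 hrs⟩
  refine ⟨⟨h.isRecurrent hy.1.1, fun n => ⟨?_, hL n, hR n⟩⟩, h.isLeftSpecial_prefix hy⟩
  have hd := hy.1.two_le
  induction n with
  | zero =>
    rw [mul_zero, zero_add, Set.ncard_eq_one]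
    refine ⟨[], Set.ext fun w => ?_⟩
    simp only [Set.mem_ofPred_eq, List.length_eq_zero_iff, Set.mem_singleton_iff]
    exact ⟨fun hw => hw.2, fun hw => ⟨hw ▸ factorAt_mem x 0 0, hw⟩⟩
  | succ n ih =>
    obtain ⟨w, ⟨hw, hrs⟩, huniq⟩ := hR n
    have hcount := ncard_factors_succ hw hrs fun z hz hz' => huniq z ⟨hz, hz'⟩
    have hall : {a | w ++ [a] ∈ language x} = Set.univ := by
      ext a
      simp only [Set.mem_ofPred_eq, Set.mem_univ, iff_true]
      rw [h.append_mem_iff]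
      exact hy.1.append_mem (h.isRightSpecial_iff.1 hrs) a
    rw [ih, hall, Set.ncard_univ, Nat.card_eq_fintype_card, Fintype.card_fin] at hcount
    rw [mul_add]
    omega

theorem unique (h : IsElemImage i x y) {x' : InfWord d} (h' : IsElemImage i x' y) : x = x' := by
  have hpos : ∀ j, blockStart i x j = blockStart i x' j := by
    intro j
    induction j with
    | zero => rfl
    | succ j ih =>
      rw [blockStart, blockStart, ← h.apply_blockStart_add_one, ← h'.apply_blockStart_add_one, ih]
  funext j
  rw [← h.apply_blockStart_add_one, ← h'.apply_blockStart_add_one, hpos]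

end IsElemImage

/-! ### Directive sequences -/

theorem exists_isElemImage {i : Fin d} {y : InfWord d} (h0 : y 0 = i)
    (hpre : ∀ p, y (p + 1) ≠ i → y p = i) : ∃ x, IsElemImage i x y := by
  let pos : ℕ → ℕ := fun j => Nat.rec 0 (fun _ p => p + if y (p + 1) = i then 1 else 2) j
  have hpos : ∀ j, pos (j + 1) = pos j + if y (pos j + 1) = i then 1 else 2 := fun _ => rfl
  have hblock : ∀ j, blockStart i (fun j => y (pos j + 1)) j = pos j := by
    intro j
    induction j with
    | zero => rfl
    | succ j ih => rw [blockStart, ih, hpos]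
  refine ⟨fun j => y (pos j + 1), isElemImage_iff.2 fun j => ?_⟩
  rw [hblock]
  refine ⟨?_, fun _ => rfl⟩
  induction j with
  | zero => exact h0
  | succ j ih =>
    rw [hpos]
    split_ifs with hj
    · exact hj
    · by_contra hne
      exact hj (hpre _ hne)

/-- The right special letter `r` precedes every letter. A letter other than `v 0` is not left
special, so `r` is its only predecessor. -/
theorem IsStandard.isRightSpecial_and_pred {v : InfWord d} (hv : IsStandard v) :
    IsRightSpecial v [v 0] ∧ ∀ p, v (p + 1) ≠ v 0 → v p = v 0 := by
  obtain ⟨w, ⟨hw, hrs⟩, -⟩ := (hv.1.2 1).2.2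
  obtain ⟨r, rfl⟩ := List.length_eq_one_iff.1 hw
  have hpred : ∀ p, v (p + 1) ≠ v 0 → v p = r := by
    intro p hp
    by_contra hne
    apply hp
    have hls : IsLeftSpecial v [v (p + 1)] := by
      refine ⟨v p, r, hne, ?_, hv.1.append_mem hrs _⟩
      exact cons_mem_language_iff.2 ⟨p, rfl, by simp [factorAt]⟩
    simpa [factorAt] using hv.eq_prefix hls
  -- If `r ≠ v 0`, then `r` is always preceded by `r`; walking back to position `0` gives a
  -- contradiction.
  have hr : r = v 0 := by
    by_contra hne
    obtain ⟨q, hq⟩ := hv.1.exists_eq r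
    induction q with
    | zero => exact hne hq.symm
    | succ q ih => exact ih (hpred q (by rwa [hq]))
  subst hr
  exact ⟨hrs, hpred⟩

theorem IsStandard.exists_desubstitution {v : InfWord d} (hv : IsStandard v) :
    ∃ x, IsStandard x ∧ IsElemImage (v 0) x v := by
  obtain ⟨hrs, hpred⟩ := hv.isRightSpecial_and_pred
  obtain ⟨x, hx⟩ := exists_isElemImage rfl hpred
  exact ⟨x, hx.isStandard hv hrs, hx⟩

/-- Each directive letter must be the first letter of the current word, and desubstitution by it is
unique. -/
theorem IsStandard.existsUnique_directiveSequence {v : InfWord d} (hv : IsStandard v) :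
    ∃! i : ℕ → Fin d, IsDirectiveSequence v i := by
  choose f hf hf' using fun y : {y : InfWord d // IsStandard y} => y.2.exists_desubstitution
  let V : ℕ → {y : InfWord d // IsStandard y} := fun n =>
    Nat.rec ⟨v, hv⟩ (fun _ y => ⟨f y, hf y⟩) n
  refine ⟨fun n => (V n).1 0, ⟨fun n => (V n).1, rfl, fun n => (V n).2, fun n => hf' (V n)⟩, ?_⟩
  rintro i ⟨W, hW0, -, hWi⟩
  have key : ∀ n, W n = (V n).1 := by
    intro n
    induction n with
    | zero => exact hW0
    | succ n ih =>
      have h1 := hWi n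
      have h2 : i n = (V n).1 0 := by
        rw [← ih]
        exact (h1.apply_blockStart 0).symm
      rw [ih, h2] at h1
      exact h1.unique (hf' (V n))
  funext n
  rw [← key]
  exact ((hWi n).apply_blockStart 0).symm

/-! ### Lengths of iterated images -/

/-- The length of `φ_{i_0} ⋯ φ_{i_{k-1}}(c)`. -/
def imageLength (i : ℕ → Fin d) : ℕ → Fin d → ℕ
  | 0, _ => 1
  | k + 1, c => if c = i k then imageLength i k c else imageLength i k (i k) + imageLength i k c

/-- The length of the `k`-th bispecial prefix of the word directed by `i`. -/
def centralLength (i : ℕ → Fin d) : ℕ → ℕ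
  | 0 => 0
  | k + 1 => centralLength i k + imageLength i k (i k)

theorem imageLength_pos (i : ℕ → Fin d) (k : ℕ) (c : Fin d) : 0 < imageLength i k c := by
  induction k generalizing c with
  | zero => exact one_pos
  | succ k ih =>
    rw [imageLength]
    split_ifs
    · exact ih c
    · exact Nat.add_pos_right _ (ih c)

theorem strictMono_centralLength (i : ℕ → Fin d) : StrictMono (centralLength i) :=
  strictMono_nat_of_lt_succ fun k => Nat.lt_add_of_pos_right (imageLength_pos i k _)

theorem imageLength_directive_le (i : ℕ → Fin d) (k : ℕ) (c : Fin d) :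
    imageLength i k (i k) ≤ imageLength i (k + 1) c := by
  rw [imageLength]
  split_ifs with h
  · rw [h]
  · exact Nat.le_add_right _ _

theorem length_composite (i : ℕ → Fin d) (k : ℕ) (w : List (Fin d)) :
    (composite i k w).length = (w.map (imageLength i k)).sum := by
  induction k generalizing w with
  | zero =>
    induction w with
    | nil => rfl
    | cons a w ih => simp [composite, imageLength, add_comm]
  | succ k ih =>
    rw [composite, ih]
    induction w with
    | nil => rfl
    | cons a w ihw =>
      rw [elemMorphism_cons, List.map_append, List.sum_append, ihw, List.map_cons, List.sum_cons,
        imageLength]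
      split_ifs with h
      · simp [h]
      · simp

/-- Each step adds `imageLength i k (i k)` to the image lengths of the `d - 1` letters other than `i
k`. This is the identity that matches the count of classes with the complexity. -/
theorem sum_imageLength (i : ℕ → Fin d) (k : ℕ) :
    ∑ c, imageLength i k c = (d - 1) * centralLength i k + d := by
  induction k with
  | zero => simp [imageLength, centralLength]
  | succ k ih =>
    have h1 : ∀ c, imageLength i (k + 1) c + (if c = i k then imageLength i k (i k) else 0) =
        imageLength i k (i k) + imageLength i k c := by
      intro c
      rw [imageLength]
      split_ifs with h
      · rw [h]
      · rfl
    have h2 := Finset.sum_congr (rfl : Finset.univ = Finset.univ) fun c _ => h1 c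
    rw [Finset.sum_add_distrib, Finset.sum_add_distrib, ih, Finset.sum_ite_eq'] at h2
    simp only [Finset.mem_univ, if_true, Finset.sum_const, Finset.card_univ, Fintype.card_fin,
      smul_eq_mul] at h2
    have hd : 0 < d := (i 0).pos
    obtain ⟨e, rfl⟩ : ∃ e, d = e + 1 := ⟨d - 1, by omega⟩
    rw [centralLength, mul_add]
    simp only [Nat.add_sub_cancel] at *
    rw [add_mul] at h2
    omega

theorem lastOcc_succ (i : ℕ → Fin d) (a : Fin d) (k : ℕ) :
    lastOcc i a (k + 1) = if i k = a then (k : WithBot ℕ) else lastOcc i a k := by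
  rw [lastOcc, Finset.range_add_one, Finset.filter_insert]
  split_ifs
  · rw [Finset.max_insert]
    apply max_eq_left
    apply Finset.max_le
    intro l hl
    rw [Finset.mem_filter, Finset.mem_range] at hl
    exact WithBot.coe_le_coe.2 hl.1.le
  · rfl

theorem lastOcc_lt (i : ℕ → Fin d) (a : Fin d) (k : ℕ) : lastOcc i a k < (k : WithBot ℕ) := by
  induction k with
  | zero => exact WithBot.bot_lt_coe 0
  | succ k ih =>
    rw [lastOcc_succ]
    have hk : (k : WithBot ℕ) < ((k + 1 : ℕ) : WithBot ℕ) := WithBot.coe_lt_coe.2 k.lt_succ_self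
    split_ifs
    · exact hk
    · exact ih.trans hk

/-- A step makes the image of `i k` the shortest and lengthens all others equally, so their order is
preserved. -/
theorem imageLength_le_of_lastOcc_le (i : ℕ → Fin d) {k : ℕ} {a b : Fin d}
    (h : lastOcc i a k ≤ lastOcc i b k) : imageLength i k b ≤ imageLength i k a := by
  induction k generalizing a b with
  | zero => rfl
  | succ k ih =>
    rw [lastOcc_succ, lastOcc_succ] at h
    by_cases hb : b = i k
    · rw [imageLength, if_pos hb, hb]
      exact imageLength_directive_le i k a
    · rw [if_neg (Ne.symm hb)] at h
      by_cases ha : a = i k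
      · rw [if_pos ha.symm] at h
        exact absurd (lastOcc_lt i b k) h.not_gt
      · rw [if_neg (Ne.symm ha)] at h
        rw [imageLength, imageLength, if_neg ha, if_neg hb]
        exact Nat.add_le_add_left (ih h) _

theorem exists_isExtremalLetter (hd : 2 ≤ d) (i : ℕ → Fin d) (k : ℕ) :
    ∃ a, IsExtremalLetter i k a := by
  have : Nontrivial (Fin d) := Fin.nontrivial_iff_two_le.2 hd
  obtain ⟨b, hb⟩ := exists_ne (i k)
  obtain ⟨a, ha, hmin⟩ := (Finset.univ.filter fun b => b ≠ i k).exists_min_image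
    (fun b => lastOcc i b k) ⟨b, by simpa using hb⟩
  simp only [Finset.mem_filter, Finset.mem_univ, true_and] at ha hmin
  refine ⟨a, ha, IsLeast.isGLB ⟨⟨a, ha, rfl⟩, ?_⟩⟩
  rintro _ ⟨c, hc, rfl⟩
  exact hmin c hc

theorem IsExtremalLetter.imageLength_le {i : ℕ → Fin d} {k : ℕ} {a : Fin d}
    (h : IsExtremalLetter i k a) {b : Fin d} (hb : b ≠ i k) :
    imageLength i k b ≤ imageLength i k a :=
  imageLength_le_of_lastOcc_le i (h.2.1 ⟨b, hb, rfl⟩)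

/-! ### The block structure of a standard word -/

/-- `V` is the sequence of standard words witnessing that `i` directs `V 0`. -/
structure IsExpansion (i : ℕ → Fin d) (V : ℕ → InfWord d) : Prop where
  isStandard : ∀ n, IsStandard (V n)
  isElemImage : ∀ n, IsElemImage (i n) (V (n + 1)) (V n)

/-- The position in `V 0` at which the image of the `j`-th letter of `V k` starts. -/
def imageStart (i : ℕ → Fin d) (V : ℕ → InfWord d) : ℕ → ℕ → ℕ
  | 0, j => j
  | k + 1, j => imageStart i V k (blockStart (i k) (V (k + 1)) j)

namespace IsExpansion

variable {i : ℕ → Fin d} {V : ℕ → InfWord d}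

theorem imageStart_zero (i : ℕ → Fin d) (V : ℕ → InfWord d) (k : ℕ) : imageStart i V k 0 = 0 := by
  induction k with
  | zero => rfl
  | succ k ih => rwa [imageStart, blockStart]

theorem imageStart_succ (h : IsExpansion i V) (k j : ℕ) :
    imageStart i V k (j + 1) = imageStart i V k j + imageLength i k (V k j) := by
  induction k generalizing j with
  | zero => rfl
  | succ k ih =>
    have h1 := (h.isElemImage k).apply_blockStart j
    have h2 := (h.isElemImage k).apply_blockStart_add_one j
    rw [imageStart, imageStart, blockStart, imageLength]
    split_ifs with hj
    · rw [ih, h1, hj]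
    · rw [show blockStart (i k) (V (k + 1)) j + 2 = blockStart (i k) (V (k + 1)) j + 1 + 1 from rfl,
        ih, ih, h1, h2, add_assoc]

theorem exists_block (h : IsExpansion i V) (k p : ℕ) :
    ∃ j s, p = imageStart i V k j + s ∧ s < imageLength i k (V k j) := by
  induction p with
  | zero => exact ⟨0, 0, by rw [imageStart_zero], imageLength_pos _ _ _⟩
  | succ p ih =>
    obtain ⟨j, s, rfl, hs⟩ := ih
    by_cases hs' : s + 1 < imageLength i k (V k j)
    · exact ⟨j, s + 1, by rw [add_assoc], hs'⟩
    · exact ⟨j + 1, 0, by rw [h.imageStart_succ]; omega, imageLength_pos _ _ _⟩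

theorem apply_of_lt_imageLength (h : IsExpansion i V) {k j j' s : ℕ} (hj : V k j = V k j')
    (hs : s < imageLength i k (V k j)) :
    V 0 (imageStart i V k j + s) = V 0 (imageStart i V k j' + s) := by
  induction k generalizing j j' s with
  | zero =>
    obtain rfl : s = 0 := Nat.lt_one_iff.1 hs
    exact hj
  | succ k ih =>
    have a1 := (h.isElemImage k).apply_blockStart j
    have a2 := (h.isElemImage k).apply_blockStart_add_one j
    have b1 := (h.isElemImage k).apply_blockStart j'
    have b2 := (h.isElemImage k).apply_blockStart_add_one j'
    rw [imageStart, imageStart]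
    by_cases hs' : s < imageLength i k (i k)
    · exact ih (a1.trans b1.symm) (by rwa [a1])
    · have hne : V (k + 1) j ≠ i k := by
        intro he
        rw [imageLength, if_pos he, he] at hs
        exact hs' hs
      rw [imageLength, if_neg hne] at hs
      obtain ⟨t, rfl⟩ := Nat.exists_eq_add_of_le (not_lt.1 hs')
      have := ih (j := blockStart (i k) (V (k + 1)) j + 1)
        (j' := blockStart (i k) (V (k + 1)) j' + 1) (s := t) (by rw [a2, b2, hj])
        (by rw [a2]; omega)
      rwa [h.imageStart_succ, h.imageStart_succ, a1, b1, add_assoc, add_assoc] at this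

/-- A block of level `k + 1` starts with a level `k` block of `i k`, and another level `k` block
starts right after it; the common prefix grows accordingly. -/
theorem apply_of_lt_centralLength (h : IsExpansion i V) {k s : ℕ} (hs : s < centralLength i k)
    (j j' : ℕ) : V 0 (imageStart i V k j + s) = V 0 (imageStart i V k j' + s) := by
  induction k generalizing j j' s with
  | zero => exact absurd hs (Nat.not_lt_zero _)
  | succ k ih =>
    have a1 := (h.isElemImage k).apply_blockStart j
    have b1 := (h.isElemImage k).apply_blockStart j'
    rw [imageStart, imageStart]
    by_cases hs' : s < imageLength i k (i k)
    · exact h.apply_of_lt_imageLength (a1.trans b1.symm) (by rwa [a1])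
    · obtain ⟨t, rfl⟩ := Nat.exists_eq_add_of_le (not_lt.1 hs')
      rw [centralLength] at hs
      have := ih (s := t) (by omega) (blockStart (i k) (V (k + 1)) j + 1)
        (blockStart (i k) (V (k + 1)) j' + 1)
      rwa [h.imageStart_succ, h.imageStart_succ, a1, b1, add_assoc, add_assoc] at this

theorem apply_centralLength (h : IsExpansion i V) (k j : ℕ) :
    V 0 (imageStart i V k j + centralLength i k) = V k j := by
  induction k generalizing j with
  | zero => rfl
  | succ k ih =>
    have a1 := (h.isElemImage k).apply_blockStart j
    have a2 := (h.isElemImage k).apply_blockStart_add_one j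
    have := ih (blockStart (i k) (V (k + 1)) j + 1)
    rw [h.imageStart_succ, a1, a2] at this
    rw [← this, imageStart, centralLength]
    congr 1
    omega

theorem apply_of_letter_eq (h : IsExpansion i V) {k j j' s : ℕ} (hj : V k j = V k j')
    (hs : s < imageLength i k (V k j) + centralLength i k) :
    V 0 (imageStart i V k j + s) = V 0 (imageStart i V k j' + s) := by
  by_cases hs' : s < imageLength i k (V k j)
  · exact h.apply_of_lt_imageLength hj hs'
  · obtain ⟨t, rfl⟩ := Nat.exists_eq_add_of_le (not_lt.1 hs')
    have := h.apply_of_lt_centralLength (k := k) (s := t) (by omega) (j + 1) (j' + 1)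
    rwa [h.imageStart_succ, h.imageStart_succ, ← hj, add_assoc, add_assoc] at this

/-- For `n + D = |B(k)|` with `D` smaller than all image lengths, the factor of length `n` at
offset `s` of a block determines, and is determined by, the offset and, if `s > D`, the letter. -/
theorem factorAt_eq_of (h : IsExpansion i V) {k n D : ℕ} (hn : n + D = centralLength i k)
    {j j' s : ℕ} (hs : s < imageLength i k (V k j)) (hc : s ≤ D ∨ V k j = V k j') :
    factorAt (V 0) (imageStart i V k j + s) n = factorAt (V 0) (imageStart i V k j' + s) n := by
  refine factorAt_eq_iff.2 fun t ht => ?_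
  rw [add_assoc, add_assoc]
  rcases hc with hc | hc
  · exact h.apply_of_lt_centralLength (by omega) j j'
  · exact h.apply_of_letter_eq hc (by omega)

/-- Counting: the classes of positions map onto the factors of length `n` and are no more numerous,
so the map is injective. -/
theorem eq_of_factorAt_eq (h : IsExpansion i V) {k n D : ℕ} (hn : n + D = centralLength i k)
    (hD : ∀ c, D < imageLength i k c) {j j' s s' : ℕ} (hs : s < imageLength i k (V k j))
    (hs' : s' < imageLength i k (V k j'))
    (heq : factorAt (V 0) (imageStart i V k j + s) n =
      factorAt (V 0) (imageStart i V k j' + s') n) :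
    s = s' ∧ (s ≤ D ∨ V k j = V k j') := by
  choose J hJ using (h.isStandard k).1.exists_eq
  let L : Set (List (Fin d)) := {w | w ∈ language (V 0) ∧ w.length = n}
  -- The left summand holds the offsets at most `D`, read in the first block. The right one holds
  -- the pairs of a letter and a larger offset, read in a chosen block of that letter.
  let g : Fin (D + 1) ⊕ (Σ c : Fin d, Fin (imageLength i k c - (D + 1))) → L := fun x =>
    ⟨Sum.elim (fun s : Fin (D + 1) => factorAt (V 0) s n)
      (fun x : Σ c : Fin d, Fin (imageLength i k c - (D + 1)) =>
        factorAt (V 0) (imageStart i V k (J x.1) + (D + 1 + x.2)) n) x, by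
      rcases x with s | x
      · exact ⟨factorAt_mem _ _ _, factorAt_length _ _ _⟩
      · exact ⟨factorAt_mem _ _ _, factorAt_length _ _ _⟩⟩
  have hg1 : ∀ j s (hs : s < D + 1), (g (Sum.inl ⟨s, hs⟩)).1 =
      factorAt (V 0) (imageStart i V k j + s) n := by
    intro j s hs
    have := h.factorAt_eq_of hn (j := 0) (j' := j) (s := s)
      (by have := hD (V k 0); omega) (Or.inl (by omega))
    rwa [imageStart_zero, zero_add] at this
  have hg2 : ∀ j s (hs : s - (D + 1) < imageLength i k (V k j) - (D + 1)), D < s →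
      (g (Sum.inr ⟨V k j, ⟨s - (D + 1), hs⟩⟩)).1 =
      factorAt (V 0) (imageStart i V k j + s) n := by
    intro j s hs hDs
    have := h.factorAt_eq_of hn (j := J (V k j)) (j' := j) (s := s)
      (by rw [hJ]; omega) (Or.inr (hJ _))
    rw [← this]
    change factorAt (V 0) (imageStart i V k (J (V k j)) + (D + 1 + (s - (D + 1)))) n = _
    rw [show D + 1 + (s - (D + 1)) = s by omega]
  have hsurj : Function.Surjective g := by
    rintro ⟨w, hw, hlen⟩
    obtain ⟨p, hp⟩ := mem_language_iff.1 hw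
    obtain ⟨j, s, rfl, hs⟩ := h.exists_block k p
    rw [hlen] at hp
    by_cases hsD : s < D + 1
    · exact ⟨Sum.inl ⟨s, hsD⟩, Subtype.ext ((hg1 j s hsD).trans hp)⟩
    · exact ⟨_, Subtype.ext ((hg2 j s (by omega) (by omega)).trans hp)⟩
  have hcard : Nat.card (Fin (D + 1) ⊕ (Σ c : Fin d, Fin (imageLength i k c - (D + 1)))) ≤
      Nat.card L := by
    have hL : Nat.card L = (d - 1) * n + 1 := ((h.isStandard 0).1.2 n).1
    rw [hL, Nat.card_eq_fintype_card, Fintype.card_sum, Fintype.card_sigma]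
    simp only [Fintype.card_fin]
    have h1 : ∑ c, (imageLength i k c - (D + 1)) + d * (D + 1) = ∑ c, imageLength i k c := by
      have : d * (D + 1) = ∑ _c : Fin d, (D + 1) := by simp
      rw [this, ← Finset.sum_add_distrib]
      exact Finset.sum_congr rfl fun c _ => Nat.sub_add_cancel (hD c)
    rw [sum_imageLength, ← hn] at h1
    obtain ⟨e, rfl⟩ : ∃ e, d = e + 1 := ⟨d - 1, by have := (i 0).pos; omega⟩
    simp only [Nat.add_sub_cancel] at *
    rw [mul_add, add_mul, mul_add] at h1
    omega
  have hinj := (hsurj.bijective_of_nat_card_le hcard).1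
  by_cases hsD : s < D + 1 <;> by_cases hsD' : s' < D + 1
  · have := hinj (Subtype.ext ((hg1 j s hsD).trans (heq.trans (hg1 j' s' hsD').symm)))
    have := congrArg Fin.val (Sum.inl.inj this)
    exact ⟨this, Or.inl (by omega)⟩
  · have := hinj (Subtype.ext ((hg1 j s hsD).trans
      (heq.trans (hg2 j' s' (by omega) (by omega)).symm)))
    cases this
  · have := hinj (Subtype.ext ((hg2 j s (by omega) (by omega)).trans
      (heq.trans (hg1 j' s' hsD').symm)))
    cases this
  · have := hinj (Subtype.ext ((hg2 j s (by omega) (by omega)).trans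
      (heq.trans (hg2 j' s' (by omega) (by omega)).symm)))
    have hlet : V k j = V k j' := congrArg Sigma.fst (Sum.inr.inj this)
    have hval : s - (D + 1) = s' - (D + 1) := by
      have := congrArg (fun x : Σ c : Fin d, Fin (imageLength i k c - (D + 1)) => x.2.1)
        (Sum.inr.inj this)
      exact this
    exact ⟨by omega, Or.inr hlet⟩

/-! ### Bispecial factors -/

theorem isRightSpecial_central (h : IsExpansion i V) (k : ℕ) :
    IsRightSpecial (V 0) (factorAt (V 0) 0 (centralLength i k)) := by
  have : Nontrivial (Fin d) := Fin.nontrivial_iff_two_le.2 (h.isStandard 0).1.two_le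
  obtain ⟨a, b, hab⟩ := exists_pair_ne (Fin d)
  have key : ∀ c, factorAt (V 0) 0 (centralLength i k) ++ [c] ∈ language (V 0) := by
    intro c
    obtain ⟨j, rfl⟩ := (h.isStandard k).1.exists_eq c
    refine append_mem_language_iff.2 ⟨imageStart i V k j, ?_, ?_⟩
    · rw [factorAt_length, factorAt_eq_iff]
      intro t ht
      rw [h.apply_of_lt_centralLength ht j 0, imageStart_zero]
    · rw [factorAt_length, h.apply_centralLength]
  exact ⟨a, b, hab, key a, key b⟩

theorem exists_bispecial_iff (h : IsExpansion i V) (m : ℕ) :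
    (∃ w, IsBispecial (V 0) w ∧ w.length = m) ↔ ∃ k, centralLength i k = m := by
  have hmono := strictMono_centralLength i
  constructor
  · rintro ⟨w, ⟨hL, a, b, hab, ha, hb⟩, rfl⟩
    have hw := (h.isStandard 0).eq_prefix hL
    by_contra hno
    have hex : ∃ k, w.length < centralLength i k :=
      ⟨w.length + 1, Nat.lt_of_lt_of_le (Nat.lt_succ_self _) hmono.le_apply⟩
    obtain ⟨k, hk⟩ : ∃ k, Nat.find hex = k + 1 := by
      refine Nat.exists_eq_succ_of_ne_zero fun h0 => ?_
      have := Nat.find_spec hex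
      rw [h0] at this
      exact absurd this (Nat.not_lt_zero _)
    have h1 : w.length < centralLength i (k + 1) := hk ▸ Nat.find_spec hex
    have h2 : centralLength i k < w.length := by
      have := Nat.find_min hex (m := k) (by omega)
      exact lt_of_le_of_ne (not_lt.1 this) fun he => hno ⟨k, he⟩
    obtain ⟨D, hD⟩ := Nat.exists_eq_add_of_le h1.le
    have hDlt : ∀ c, D < imageLength i (k + 1) c := fun c => by
      have h3 := imageLength_directive_le i k c
      have h4 : centralLength i (k + 1) = centralLength i k + imageLength i k (i k) := rfl
      omega
    -- A prefix of length strictly between two central lengths occurs only at block starts of level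
    -- `k + 1`, where the next letter still lies in the common prefix.
    have key : ∀ c, w ++ [c] ∈ language (V 0) → c = V 0 w.length := by
      intro c hc
      obtain ⟨p, hp, rfl⟩ := append_mem_language_iff.1 hc
      obtain ⟨j, s, rfl, hs⟩ := h.exists_block (k + 1) p
      have := h.eq_of_factorAt_eq hD.symm hDlt (j' := 0) (s' := 0) hs (imageLength_pos _ _ _)
        (by rw [hp, imageStart_zero, add_zero, ← hw])
      obtain rfl := this.1
      rw [add_zero, h.apply_of_lt_centralLength h1 j 0, imageStart_zero, zero_add]
    exact hab ((key a ha).trans (key b hb).symm)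
  · rintro ⟨k, rfl⟩
    exact ⟨_, ⟨(h.isStandard 0).2 _, h.isRightSpecial_central k⟩, factorAt_length _ _ _⟩

theorem length_bispecial (h : IsExpansion i V) {u : InfWord d}
    (hu : language (V 0) = language u) (k : ℕ) :
    (bispecial u k).length = centralLength i k := by
  have hmono := strictMono_centralLength i
  have hset : (fun m => ∃ w : List (Fin d), IsBispecial u w ∧ w.length = m) =
      fun m => ∃ k, centralLength i k = m := by
    funext m
    simp only [← isBispecial_congr hu]
    exact propext (h.exists_bispecial_iff m)
  have hinf : (Set.ofPred fun m => ∃ k, centralLength i k = m).Infinite :=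
    Set.infinite_range_of_injective hmono.injective
  have hnth : Nat.nth (fun m => ∃ k, centralLength i k = m) = centralLength i :=
    ((Nat.nth_strictMono hinf).range_inj hmono).1 (Nat.range_nth_of_infinite hinf)
  have hex : ∃ w, IsBispecial u w ∧
      w.length = Nat.nth (fun m => ∃ v : List (Fin d), IsBispecial u v ∧ v.length = m) k := by
    rw [hset, hnth]
    have := (h.exists_bispecial_iff (centralLength i k)).2 ⟨k, rfl⟩
    simpa only [isBispecial_congr hu] using this
  exact (Classical.epsilon_spec hex).2.trans (by rw [hset, hnth])

end IsExpansion

theorem existsUnique_level {f : ℕ → ℕ} (hf : StrictMono f) (h0 : f 0 = 0) {n : ℕ} (hn : 1 ≤ n) :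
    ∃! k, 1 ≤ k ∧ f (k - 1) < n ∧ n ≤ f k := by
  have hex : ∃ k, n ≤ f k := ⟨n, hf.le_apply⟩
  have hpos : 1 ≤ Nat.find hex := by
    by_contra hlt
    have := Nat.find_spec hex
    rw [show Nat.find hex = 0 by omega, h0] at this
    omega
  refine ⟨Nat.find hex, ⟨hpos, ?_, Nat.find_spec hex⟩, ?_⟩
  · exact not_le.1 (Nat.find_min hex (by omega))
  · rintro k ⟨hk, h1, h2⟩
    apply le_antisymm
    · by_contra hlt
      have := (Nat.find_spec hex).trans (hf.monotone (show Nat.find hex ≤ k - 1 by omega))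
      omega
    · exact Nat.find_min' hex h2

/-! ### Non-repetitive complexity -/

/-- A run of `m` positions is visible in a window of length `m + n`, so only the language matters.
-/
theorem nonrepetitiveLengths_subset {u v : InfWord d} (h : language v ⊆ language u) (n : ℕ) :
    nonrepetitiveLengths v n ⊆ nonrepetitiveLengths u n := by
  rintro m ⟨k, hk⟩
  obtain ⟨r, hr⟩ := mem_language_iff.1 (h (factorAt_mem v k (m + n)))
  rw [factorAt_length, factorAt_eq_iff] at hr
  have hfac : ∀ s < m, factorAt u (r + s) n = factorAt v (k + s) n := fun s hs =>
    factorAt_eq_iff.2 fun t ht => by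
      rw [add_assoc, add_assoc]
      exact hr _ (by omega)
  refine ⟨r, fun p q hp hpq hq => ?_⟩
  obtain ⟨s, rfl⟩ := Nat.exists_eq_add_of_le hp
  obtain ⟨t, rfl⟩ := Nat.exists_eq_add_of_le (hp.trans hpq.le)
  rw [hfac s (by omega), hfac t (by omega)]
  exact hk _ _ (by omega) (by omega) (by omega)

namespace IsExpansion

variable {i : ℕ → Fin d} {V : ℕ → InfWord d}

theorem eq_directive_of_ne (h : IsExpansion i V) {k j : ℕ} (hne : V k j ≠ V k (j + 1)) :
    V k j = i k ∨ V k (j + 1) = i k := by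
  obtain ⟨l, rfl | ⟨rfl, hl⟩⟩ := eq_blockStart_or (i k) (V (k + 1)) j
  · exact Or.inl ((h.isElemImage k).apply_blockStart l)
  · right
    have := (h.isElemImage k).apply_blockStart (l + 1)
    rwa [blockStart, if_neg hl] at this

theorem isGreatest_nonrepetitiveLengths (h : IsExpansion i V) {k n D : ℕ}
    (hn : n + D = centralLength i k) (hD : ∀ c, D < imageLength i k c) {a : Fin d} (ha : a ≠ i k)
    (hmax : ∀ b, b ≠ i k → imageLength i k b ≤ imageLength i k a) :
    IsGreatest (nonrepetitiveLengths (V 0) n)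
      (imageLength i k (i k) + imageLength i k a - (D + 1)) := by
  have hDi := hD (i k)
  have hDa := hD a
  constructor
  · obtain ⟨l, hl⟩ := (h.isStandard (k + 1)).1.exists_eq a
    obtain ⟨j, hj, hj'⟩ : ∃ j, V k j = i k ∧ V k (j + 1) = a :=
      ⟨_, (h.isElemImage k).apply_blockStart l,
        ((h.isElemImage k).apply_blockStart_add_one l).trans hl⟩
    have e1 := h.imageStart_succ k j
    rw [hj] at e1
    have hpos : ∀ p, imageStart i V k j + (D + 1) ≤ p →
        p < imageStart i V k j + (D + 1) +
          (imageLength i k (i k) + imageLength i k a - (D + 1)) →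
        (∃ s, p = imageStart i V k j + s ∧ D < s ∧ s < imageLength i k (V k j)) ∨
          ∃ s, p = imageStart i V k (j + 1) + s ∧ s < imageLength i k (V k (j + 1)) := by
      intro p hp1 hp2
      rw [hj, hj']
      by_cases hp : p < imageStart i V k (j + 1)
      · exact Or.inl ⟨p - imageStart i V k j, by omega, by omega, by omega⟩
      · exact Or.inr ⟨p - imageStart i V k (j + 1), by omega, by omega⟩
    -- In the block of `i k` only offsets beyond `D` are used. There the letter is visible, so
    -- nothing can be repeated in the block of `a`.
    refine ⟨imageStart i V k j + (D + 1), fun p q hp hpq hq heq => ?_⟩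
    rcases hpos p hp (hpq.trans hq) with ⟨s, rfl, hDs, hs⟩ | ⟨s, rfl, hs⟩ <;>
      rcases hpos q (hp.trans hpq.le) hq with ⟨t, rfl, hDt, ht⟩ | ⟨t, rfl, ht⟩ <;>
      obtain ⟨rfl, hc⟩ := h.eq_of_factorAt_eq hn hD hs ht heq
    · omega
    · rw [hj, hj'] at hc
      exact hc.elim (fun hc => by omega) fun hc => ha hc.symm
    · omega
    · omega
  · rintro m ⟨K, hK⟩
    obtain ⟨j, s, rfl, hs⟩ := h.exists_block k K
    have hle : ∀ c, imageLength i k c ≤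
        imageLength i k (i k) + imageLength i k a - (D + 1) := by
      intro c
      by_cases hc : c = i k
      · rw [hc]
        omega
      · have := hmax c hc
        omega
    have e1 := h.imageStart_succ k j
    have e2 := h.imageStart_succ k (j + 1)
    have p1 := imageLength_pos i k (V k j)
    have p2 := imageLength_pos i k (V k (j + 1))
    -- In the first case the factor at `K` recurs at the same offset of the next block. In the
    -- second, `s ≥ D + 1` and the two letters differ, so one of them is `i k`; the next two block
    -- starts carry equal factors, which bounds the run.
    by_cases hc : s ≤ D ∨ V k j = V k (j + 1)
    · refine le_trans ?_ (hle (V k j))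
      by_contra hlt
      exact hK _ (imageStart i V k (j + 1) + s) le_rfl (by omega) (by omega)
        (h.factorAt_eq_of hn hs hc)
    · push Not at hc
      have hsum : imageLength i k (V k j) + imageLength i k (V k (j + 1)) ≤
          imageLength i k (i k) + imageLength i k a := by
        rcases h.eq_directive_of_ne hc.2 with he | he
        · rw [he]
          exact Nat.add_le_add_left (hmax _ (he ▸ hc.2.symm)) _
        · rw [he, add_comm]
          exact Nat.add_le_add_left (hmax _ (he ▸ hc.2)) _
      by_contra hlt
      exact hK (imageStart i V k (j + 1)) (imageStart i V k (j + 1 + 1)) (by omega) (by omega)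
        (by omega) (h.factorAt_eq_of hn (s := 0) p2 (Or.inl (Nat.zero_le _)))

end IsExpansion

end ArnouxRauzy

theorem theorem13 {d : ℕ} (u : ArnouxRauzy.InfWord d) (hu : ArnouxRauzy.IsArnouxRauzy u) :
    -- the standard word `v` with the language of `u` and its directive sequence `i`
    -- exist and are unique
    (∃! v : ArnouxRauzy.InfWord d,
      ArnouxRauzy.IsStandard v ∧ ArnouxRauzy.language v = ArnouxRauzy.language u) ∧
    ∀ v : ArnouxRauzy.InfWord d, ArnouxRauzy.IsStandard v →
      ArnouxRauzy.language v = ArnouxRauzy.language u →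
      (∃! i : ℕ → Fin d, ArnouxRauzy.IsDirectiveSequence v i) ∧
      ∀ i : ℕ → Fin d, ArnouxRauzy.IsDirectiveSequence v i →
        ∀ n : ℕ, 1 ≤ n →
          (∃! k : ℕ, ArnouxRauzy.IsLevel u n k) ∧
          ∀ k : ℕ, ArnouxRauzy.IsLevel u n k →
            (∃ a : Fin d, ArnouxRauzy.IsExtremalLetter i k a) ∧
            ∀ a : Fin d, ArnouxRauzy.IsExtremalLetter i k a →
              -- the maximum defining the complexity is attained, and has the stated value
              IsGreatest (ArnouxRauzy.nonrepetitiveLengths u n) (ArnouxRauzy.nrC u n) ∧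
              (ArnouxRauzy.nrC u n : ℤ) =
                ((ArnouxRauzy.composite i (k + 1) [a]).length : ℤ) - 1
                  - ((ArnouxRauzy.bispecial u k).length : ℤ) + (n : ℤ) := by
  open ArnouxRauzy in
  refine ⟨hu.existsUnique_standard, fun v hv hlang => ⟨hv.existsUnique_directiveSequence, ?_⟩⟩
  rintro i ⟨V, rfl, hV, hVi⟩ n hn
  have h : IsExpansion i V := ⟨hV, hVi⟩
  have hB := h.length_bispecial hlang
  simp only [IsLevel, hB]
  refine ⟨existsUnique_level (strictMono_centralLength i) rfl hn, ?_⟩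
  rintro k ⟨hk, hlt, hle⟩
  refine ⟨exists_isExtremalLetter hu.two_le i k, fun a ha => ?_⟩
  obtain ⟨D, hD⟩ := Nat.exists_eq_add_of_le hle
  -- Since `n` exceeds the previous central length, `D` is less than the difference of the two, an
  -- image length of level `k - 1` that is at most every image length of level `k`.
  have hDlt : ∀ c, D < imageLength i k c := by
    intro c
    obtain ⟨k, rfl⟩ := Nat.exists_eq_add_of_le' hk
    have h1 := imageLength_directive_le i k c
    have h2 : centralLength i (k + 1) = centralLength i k + imageLength i k (i k) := rfl
    rw [Nat.add_sub_cancel] at hlt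
    omega
  have hg := h.isGreatest_nonrepetitiveLengths hD.symm hDlt ha.1 fun b hb => ha.imageLength_le hb
  rw [(nonrepetitiveLengths_subset hlang.le n).antisymm
    (nonrepetitiveLengths_subset hlang.ge n)] at hg
  have hnr : nrC u n = _ := hg.csSup_eq
  rw [hnr]
  refine ⟨hg, ?_⟩
  have h3 : (composite i (k + 1) [a]).length = imageLength i k (i k) + imageLength i k a := by
    rw [length_composite, List.map_singleton, List.sum_singleton, imageLength, if_neg ha.1]
  have h4 := hDlt a
  rw [h3, hD]
  omega
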